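/- Let $n \ge 4$, and let $\mathbb{G}$ be a reflexive $n$-cycle, that is, a digraph with vertex set $\{0,1,\dots,n-1\}$ such that $(i,i)$ is an arc for every vertex $i$; for each $0 \le i < n-1$, one or both of the arcs $(i,i+1)$, $(i+1,i)$ is present; one or both of the arcs $(n-1,0)$, $(0,n-1)$ is present; and there are no other arcs. Then $\mathbb{G}$ is Słupecki, that is, all its surjective polymorphisms are essentially unary: for every integer $k \ge 1$ and every surjective map $f : \{0,\dots,n-1\}^k \to \{0,\dots,n-1\}$ such that $(f(x_1,\dots,x_k), f(y_1,\dots,y_k))$ is an arc of $\mathbb{G}$ whenever $(x_1,y_1),\dots,(x_k,y_k)$ are all arcs of $\mathbb{G}$, there exist an index $1 \le i \le k$ and a homomorphism $g : \mathbb{G} \to \mathbb{G}$ (a map on the vertices that sends arcs to arcs) such that $f(x_1,\dots,x_k) = g(x_i)$ for all $x_1,\dots,x_k \in \{0,\dots,n-1\}$. -/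

import Mathlib

namespace ReflexiveCycle

/-- A map between the vertex sets of two digraphs is a homomorphism if it preserves arcs. -/
def IsHom {V W : Type*} (G : Digraph V) (H : Digraph W) (f : V → W) : Prop :=
  ∀ ⦃x y : V⦄, G.Adj x y → H.Adj (f x) (f y)

/-- The `k`-th power of a digraph: arcs are taken coordinatewise. -/
def power {V : Type*} (G : Digraph V) (k : ℕ) : Digraph (Fin k → V) where
  Adj x y := ∀ i, G.Adj (x i) (y i)

/-- A `k`-ary polymorphism of `G` is a homomorphism from the `k`-th power of `G` to `G`. -/
def IsPolymorphism {V : Type*} (G : Digraph V) {k : ℕ} (f : (Fin k → V) → V) : Prop :=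
  IsHom (power G k) G f

/-- `f` is essentially unary: `f (x₁, …, x_k) = g (x_i)` for some coordinate `i` and some
endomorphism `g` of `G`. -/
def IsEssentiallyUnary {V : Type*} (G : Digraph V) {k : ℕ} (f : (Fin k → V) → V) : Prop :=
  ∃ (i : Fin k) (g : V → V), IsHom G G g ∧ ∀ x, f x = g (x i)

/-- A digraph is Słupecki if all its surjective polymorphisms, of any positive arity, are
essentially unary. -/
def IsSlupecki {V : Type*} (G : Digraph V) : Prop :=
  ∀ (k : ℕ), 1 ≤ k → ∀ f : (Fin k → V) → V,
    IsPolymorphism G f → Function.Surjective f → IsEssentiallyUnary G f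

/-- `j` is the cyclic successor of `i` on `{0, …, n - 1}`: either `j = i + 1`, or
`i = n - 1` and `j = 0`. -/
def IsNext {n : ℕ} (i j : Fin n) : Prop :=
  (i : ℕ) + 1 = j ∨ ((i : ℕ) + 1 = n ∧ (j : ℕ) = 0)

/-- A reflexive `n`-cycle on the vertex set `{0, …, n - 1}`: all loops are present, one or both
of the arcs between each vertex and its cyclic successor are present, and there are no other
arcs. -/
structure IsReflexiveCycle {n : ℕ} (G : Digraph (Fin n)) : Prop where
  refl : ∀ i, G.Adj i i
  edge : ∀ i j, IsNext i j → G.Adj i j ∨ G.Adj j i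
  only : ∀ i j, G.Adj i j → i = j ∨ IsNext i j ∨ IsNext j i

end ReflexiveCycle

namespace ReflexiveCycle

/-! Compose `f` with the covering map from the integers and lift the result to `F : ℤ^k → ℤ`
(`exists_lift`). Lifting works because `n ≥ 4`: triangles of the cycle do not wind around it. Along
each coordinate `F` has winding number 0, 1 or -1 (`exists_winding`).

If some winding number is nonzero, `F` moves at unit speed along that coordinate. This leaves no
room for dependence on any other coordinate (`eq_of_unit_speed`), so `f` is essentially unary.

If all winding numbers vanish, `F` is `n`-periodic in every coordinate, hence takes finitely many
values. Let `m` be its minimum. By surjectivity some value of `F` is congruent to `m - 1`, hence is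
at least `m + n - 1`. A word prescribing the directions of the arcs of a walk contradicts this if it
joins every pair of vertices of the cycle but cannot lead from `m` to `m + n - 1` in the cover.
Walks reading one word combine coordinatewise into a walk in the power, and `F` carries that walk to
a forbidden one. Such a word always exists (`exists_separates`); finding it is the combinatorial
core. -/

open Classical in
/-- One rightward step on `ℤ`: cross the edge between `z` and `z + 1` if it admits the letter `b`,
otherwise stay. -/
noncomputable def step (adm : Bool → ℤ → Prop) (b : Bool) (z : ℤ) : ℤ :=
  if adm b z then z + 1 else z

/-- The rightmost position reachable from a given one by reading a word. -/
noncomputable def run (adm : Bool → ℤ → Prop) : List Bool → ℤ → ℤ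
  | [], z => z
  | b :: w, z => run adm w (step adm b z)

/-- The word read along the same walk in the opposite direction. -/
def inv (w : List Bool) : List Bool := (w.map not).reverse

/-! ### Greedy rightward runs -/

section Run

variable {adm : Bool → ℤ → Prop}

@[simp] lemma run_nil (z : ℤ) : run adm [] z = z := rfl

@[simp] lemma run_cons (b : Bool) (w : List Bool) (z : ℤ) :
    run adm (b :: w) z = run adm w (step adm b z) := rfl

lemma run_append (v w : List Bool) (z : ℤ) : run adm (v ++ w) z = run adm w (run adm v z) := by
  induction v generalizing z with
  | nil => rfl
  | cons b v ih => simp [ih]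

lemma step_pos {b : Bool} {z : ℤ} (h : adm b z) : step adm b z = z + 1 := if_pos h

lemma step_neg {b : Bool} {z : ℤ} (h : ¬ adm b z) : step adm b z = z := if_neg h

lemma le_step (b : Bool) (z : ℤ) : z ≤ step adm b z := by
  unfold step; split_ifs <;> omega

lemma step_le (b : Bool) (z : ℤ) : step adm b z ≤ z + 1 := by
  unfold step; split_ifs <;> omega

lemma step_mono (b : Bool) : Monotone (step adm b) := by
  intro x y h
  rcases h.eq_or_lt with rfl | h
  · exact le_rfl
  · exact (step_le b x).trans (le_trans h (le_step b y))

lemma le_run (w : List Bool) (z : ℤ) : z ≤ run adm w z := by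
  induction w generalizing z with
  | nil => exact le_rfl
  | cons b w ih => exact (le_step b z).trans (ih _)

lemma run_mono (w : List Bool) : Monotone (run adm w) := by
  induction w with
  | nil => exact fun _ _ h => h
  | cons b w ih => exact fun x y h => ih (step_mono b h)

lemma run_le_add_length (w : List Bool) (z : ℤ) : run adm w z ≤ z + w.length := by
  induction w generalizing z with
  | nil => simp
  | cons b w ih =>
    have := ih (step adm b z)
    have := step_le (adm := adm) b z
    simp only [run_cons, List.length_cons]
    push_cast
    omega

lemma run_replicate_le {b : Bool} {u z : ℤ} (hu : ¬ adm b u) (hz : z ≤ u) (M : ℕ) :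
    run adm (List.replicate M b) z ≤ u := by
  induction M generalizing z with
  | zero => exact hz
  | succ M ih =>
    refine ih ?_
    have := step_mono (adm := adm) b hz
    rwa [step_neg hu] at this

lemma le_run_replicate {b : Bool} {y z z' : ℤ} {M : ℕ} (hz : z ≤ z')
    (h : ∀ u, z ≤ u → u < y → adm b u) (hy : y ≤ z' + M) :
    y ≤ run adm (List.replicate M b) z' := by
  induction M generalizing z' with
  | zero => simpa using hy
  | succ M ih =>
    by_cases hlt : z' < y
    · simp only [List.replicate_succ, run_cons, step_pos (h z' hz hlt)]
      refine ih (by omega) ?_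
      push_cast at hy
      omega
    · exact (not_lt.1 hlt).trans (le_run _ _)

lemma lt_step {b : Bool} {u z : ℤ} (hu : adm b u) (hz : u ≤ z) : u + 1 ≤ step adm b z := by
  have := step_mono (adm := adm) b hz
  rwa [step_pos hu] at this

lemma inv_append (v w : List Bool) : inv (v ++ w) = inv w ++ inv v := by
  simp [inv]

lemma inv_cons (b : Bool) (w : List Bool) : inv (b :: w) = inv w ++ [!b] := by
  simp [inv]

lemma inv_replicate (M : ℕ) (b : Bool) : inv (List.replicate M b) = List.replicate M (!b) := by
  simp [inv]

end Run

/-! ### Periodic edge data and separating words -/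

/-- The edge data of the universal cover of a reflexive `n`-cycle: `adm b z` says that the edge
between `z` and `z + 1` may be crossed to the right along (`b = true`) or against (`b = false`)
an arc. -/
structure IsCover (n : ℕ) (adm : Bool → ℤ → Prop) : Prop where
  four_le : 4 ≤ n
  periodic : ∀ b z, adm b (z + n) ↔ adm b z
  total : ∀ b z, adm b z ∨ adm (!b) z

/-- `w` is too short to lead from `m` to `m + n - 1` in the universal cover, although it joins
any two vertices of the cycle itself. -/
def Separates (n : ℕ) (adm : Bool → ℤ → Prop) (m : ℤ) (w : List Bool) : Prop :=
  run adm w m ≤ m + n - 2 ∧ ∀ x, x + n ≤ run adm (inv w) (run adm w x + 1)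

namespace IsCover

variable {n : ℕ} {adm : Bool → ℤ → Prop}

lemma flip (h : IsCover n adm) : IsCover n (fun b => adm (!b)) :=
  ⟨h.four_le, fun _ => h.periodic _, fun _ => h.total _⟩

lemma adm_congr (h : IsCover n adm) {b : Bool} {y z : ℤ} (hd : (n : ℤ) ∣ y - z) :
    adm b y ↔ adm b z := by
  obtain ⟨c, hc⟩ := hd
  have key : Function.Periodic (adm b) (n : ℤ) := fun z => propext (h.periodic b z)
  have := key.zsmul c z
  rw [show z + c • (n : ℤ) = y by rw [smul_eq_mul]; linarith] at this
  rw [this]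

lemma exists_next (h : IsCover n adm) (z c : ℤ) :
    ∃ q, z ≤ q ∧ q < z + n ∧ (n : ℤ) ∣ q - c := by
  have h4 := h.four_le
  have hn : (0 : ℤ) < n := by omega
  refine ⟨z + (c - z) % n, ?_, ?_, ?_⟩
  · have := Int.emod_nonneg (c - z) hn.ne'
    omega
  · have := Int.emod_lt_of_pos (c - z) hn
    omega
  · rw [Int.emod_def]
    exact ⟨-((c - z) / n), by ring⟩

lemma run_add (h : IsCover n adm) (w : List Bool) (z : ℤ) :
    run adm w (z + n) = run adm w z + n := by
  induction w generalizing z with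
  | nil => rfl
  | cons b w ih =>
    rw [run_cons, run_cons, ← ih]
    congr 1
    by_cases hz : adm b z
    · rw [step_pos hz, step_pos ((h.periodic b z).2 hz)]
      ring
    · rw [step_neg hz, step_neg (mt (h.periodic b z).1 hz)]

lemma run_add_mul (h : IsCover n adm) (w : List Bool) (z : ℤ) (c : ℕ) :
    run adm w (z + c * n) = run adm w z + c * n := by
  induction c with
  | zero => simp
  | succ c ih =>
    rw [show z + ((c + 1 : ℕ) : ℤ) * n = (z + c * n) + n by push_cast; ring, h.run_add, ih]
    push_cast; ring

end IsCover

/-! ### Alternating words and reversal of arcs -/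

/-- The word consisting of `i` alternating blocks of length `n`, the first one of letter `a`. -/
def alternating (n : ℕ) : Bool → ℕ → List Bool
  | _, 0 => []
  | a, i + 1 => List.replicate n a ++ alternating n (!a) i

/-- The letter of the `i`-th block of an alternating word. -/
def letter : Bool → ℕ → Bool
  | a, 0 => a
  | a, i + 1 => letter (!a) i

lemma letter_not (a : Bool) (i : ℕ) : letter (!a) i = !letter a i := by
  induction i generalizing a with
  | zero => rfl
  | succ i ih => exact ih _

lemma letter_letter (a : Bool) (i : ℕ) : letter (letter a i) i = a := by
  induction i generalizing a with
  | zero => rfl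
  | succ i ih => simp only [letter, letter_not, ih, Bool.not_not]

lemma letter_two_mul (a : Bool) (i : ℕ) : letter a (2 * i) = a := by
  induction i with
  | zero => rfl
  | succ i ih =>
    rw [Nat.mul_succ]
    simp only [letter, Bool.not_not]
    exact ih

lemma alternating_add {n : ℕ} (a : Bool) (i j : ℕ) :
    alternating n a (i + j) = alternating n a i ++ alternating n (letter a i) j := by
  induction i generalizing a with
  | zero => simp [alternating, letter]
  | succ i ih =>
    rw [Nat.add_right_comm]
    simp [alternating, ih, letter]

lemma inv_alternating {n : ℕ} (a : Bool) (i : ℕ) :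
    inv (alternating n a i) = alternating n (letter a i) i := by
  induction i generalizing a with
  | zero => rfl
  | succ i ih =>
    rw [alternating, inv_append, ih, inv_replicate, alternating_add (j := 1)]
    simp only [letter, alternating, List.append_nil]
    congr 2
    exact (letter_letter _ _).symm

section Flip

variable {adm : Bool → ℤ → Prop}

lemma run_flip (w : List Bool) (z : ℤ) :
    run (fun b => adm (!b)) w z = run adm (w.map not) z := by
  induction w generalizing z with
  | nil => rfl
  | cons b w ih => exact ih _

lemma Separates.of_flip {n : ℕ} {m : ℤ} {w : List Bool}
    (h : Separates n (fun b => adm (!b)) m w) : Separates n adm m (w.map not) := by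
  refine ⟨by simpa only [run_flip] using h.1, fun x => ?_⟩
  simpa only [run_flip, inv, List.map_reverse] using h.2 x

end Flip

/-! ### Construction of separating words -/

namespace IsCover

variable {n : ℕ} {adm : Bool → ℤ → Prop}

/-- An edge of the path from `m` to `m + n - 1` that blocks `false` stops a block of `false`, whose
inverse runs freely. If there is none, a word of length `n - 2` is too short to reach `m + n - 1`.
-/
lemma exists_separates_of_forall_adm (h : IsCover n adm) (m : ℤ) (ht : ∀ z, adm true z) :
    ∃ w, Separates n adm m w := by
  have h4 := h.four_le
  by_cases hP : ∃ j, m ≤ j ∧ j ≤ m + n - 2 ∧ ¬ adm false j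
  · obtain ⟨j, hj, hj', hja⟩ := hP
    refine ⟨List.replicate n false, (run_replicate_le hja hj n).trans hj', fun x => ?_⟩
    rw [inv_replicate]
    have h1 := le_run (adm := adm) (List.replicate n false) x
    exact le_run_replicate (z := x) (by omega) (fun u _ _ => ht u) (by omega)
  · push Not at hP
    refine ⟨true :: List.replicate (n - 3) false, ?_, fun x => ?_⟩
    · refine (run_le_add_length _ _).trans ?_
      simp only [List.length_cons, List.length_replicate]
      omega
    · rw [inv_cons, inv_replicate, run_append, run_cons true, step_pos (ht x)]
      by_cases hx : adm false (x + 1)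
      · have h1 : x + 2 ≤ run adm (List.replicate (n - 3) false) (x + 1) :=
          le_run_replicate le_rfl (fun u hu hu' => by rwa [show u = x + 1 by omega]) (by omega)
        refine le_trans ?_ (le_run _ _)
        exact le_run_replicate (z := x) (by omega) (fun u _ _ => ht u) (by omega)
      -- Here `x + 1` lies over the closing edge, the only one that can block `false`. The last
      -- letter of the inverse word supplies the missing step, across a lift of the path edge at `m
      -- + n - 3`.
      · have h1 := le_run (adm := adm) (List.replicate (n - 3) false) (x + 1)
        have h2 : x + n - 1 ≤ run adm (List.replicate (n - 3) true)
            (run adm (List.replicate (n - 3) false) (x + 1) + 1) :=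
          le_run_replicate (z := x) (by omega) (fun u _ _ => ht u) (by omega)
        have h3 : adm false (x + n - 1) := by
          obtain ⟨q, hq, hq', hqd⟩ := h.exists_next m (x + 1)
          have hqa : ¬ adm false q := by rwa [h.adm_congr hqd]
          have hq2 : q = m + n - 1 := by
            by_contra hne
            exact hqa (hP q hq (by omega))
          refine (h.adm_congr ?_).2 (hP (m + n - 3) (by omega) (by omega))
          obtain ⟨c, hc⟩ := hqd
          exact ⟨1 - c, by rw [mul_sub, ← hc]; omega⟩
        have := lt_step h3 h2
        simp only [Bool.not_true, Bool.not_false, run_cons, run_nil]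
        omega

/-- Runs of `true` stop only at lifts of the closing edge, which `false` crosses. The word is chosen
by where `false` is blocked on the path. -/
lemma exists_separates_of_closing (h : IsCover n adm) (m : ℤ)
    (hP : ∀ z, m ≤ z → z ≤ m + n - 2 → adm true z) (hc : ¬ adm true (m + n - 1))
    (hf : ∃ z, ¬ adm false z) : ∃ w, Separates n adm m w := by
  have h4 := h.four_le
  have hcf : adm false (m + n - 1) := (h.total true _).resolve_left hc
  -- between two consecutive lifts of the closing edge, `true` is admitted
  have htrue : ∀ q, (n : ℤ) ∣ q - (m + n - 1) → ∀ u, q - n < u → u < q → adm true u := by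
    intro q hq u hu hu'
    refine (h.adm_congr (z := u - q + (m + n - 1)) ?_).2 (hP _ (by omega) (by omega))
    rwa [show u - (u - q + (m + n - 1)) = q - (m + n - 1) by ring]
  have hcross : ∀ q, (n : ℤ) ∣ q - (m + n - 1) → ∀ z, q ≤ z →
      q + n ≤ run adm (List.replicate n true) (step adm false z) := by
    intro q hq z hz
    have h1 := lt_step ((h.adm_congr hq).2 hcf) hz
    refine le_run_replicate h1 (fun u hu hu' => htrue (q + n) ?_ u (by omega) hu') (by omega)
    rw [show q + n - (m + n - 1) = q - (m + n - 1) + n by ring]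
    exact dvd_add hq dvd_rfl
  obtain ⟨j, hj, hj', hja⟩ : ∃ j, m ≤ j ∧ j ≤ m + n - 2 ∧ ¬ adm false j := by
    obtain ⟨z, hz⟩ := hf
    obtain ⟨q, hq, hq', hqd⟩ := h.exists_next m z
    have hqa : ¬ adm false q := by rwa [h.adm_congr hqd]
    refine ⟨q, hq, ?_, hqa⟩
    by_contra hlt
    exact hqa (by rwa [show q = m + n - 1 by omega])
  by_cases h2 : ∃ i, j ≠ i ∧ m ≤ i ∧ i ≤ m + n - 2 ∧ ¬ adm false i
  · obtain ⟨a, c, ha, hac, hc', haa, hca⟩ :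
        ∃ a c, m ≤ a ∧ a < c ∧ c ≤ m + n - 2 ∧ ¬ adm false a ∧ ¬ adm false c := by
      obtain ⟨i, hne, hi, hi', hia⟩ := h2
      rcases lt_or_gt_of_ne hne with hlt | hlt
      · exact ⟨j, i, hj, hlt, hi', hja, hia⟩
      · exact ⟨i, j, hi, hlt, hj', hia, hja⟩
    -- The blocked edges `a < c` stop the two blocks in turn, since the single `true` leads at most
    -- to `a + 1 ≤ c`. The inverse runs to a lift of the closing edge, crosses it and runs on to the
    -- next lift.
    refine ⟨List.replicate n false ++ true :: List.replicate n false, ?_, fun x => ?_⟩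
    · rw [run_append, run_cons]
      have h1 := run_replicate_le haa ha n
      have h3 := step_le (adm := adm) true (run adm (List.replicate n false) m)
      exact (run_replicate_le hca (by omega) n).trans hc'
    · rw [inv_append, inv_cons, inv_replicate, run_append, run_append]
      set z := run adm (List.replicate n false ++ true :: List.replicate n false) x + 1 with hz
      have hxz : x ≤ z := by
        have := le_run (adm := adm) (List.replicate n false ++ true :: List.replicate n false) x
        omega
      obtain ⟨q, hq, hq', hqd⟩ := h.exists_next z (m + n - 1)
      have h1 : q ≤ run adm (List.replicate n (!false)) z :=
        le_run_replicate le_rfl (fun u hu hu' => htrue q hqd u (by omega) hu') (by omega)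
      have := hcross q hqd _ h1
      simp only [Bool.not_true, run_cons, run_nil, Bool.not_false] at this ⊢
      omega
  · push Not at h2
    have hfalse : ∀ s, (n : ℤ) ∣ s - j → ∀ u, s - n < u → u < s → adm false u := by
      intro s hs u hu hu'
      obtain ⟨v, hv, hv', hvd⟩ := h.exists_next m u
      have hvu : (n : ℤ) ∣ u - v := by rw [← neg_sub]; exact (dvd_neg).2 hvd
      refine (h.adm_congr hvu).2 ?_
      by_cases hvc : v = m + n - 1
      · rwa [hvc]
      · refine h2 v (fun hjv => ?_) hv (by omega)
        obtain ⟨c, hc⟩ := hs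
        obtain ⟨d, hd⟩ := hvu
        have h3 : s - u = n * (c - d) := by rw [mul_sub, ← hc, ← hd, hjv]; ring
        have h5 : 0 < c - d := by
          by_contra hle
          nlinarith
        have h6 : c - d < 1 := by
          by_contra hle
          nlinarith
        omega
    by_cases hjn : j = m + n - 2
    -- The `true` block has just the length that ends at the blocked edge `j`. It reaches the next
    -- closing lift `q` from every `x` except `q - n + 1`, which is treated separately.
    · refine ⟨List.replicate (n - 2) true ++ List.replicate n false, ?_, fun x => ?_⟩
      · rw [run_append, ← hjn]
        refine run_replicate_le hja ((run_le_add_length _ _).trans ?_) n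
        simp only [List.length_replicate]
        omega
      · rw [inv_append, inv_replicate, inv_replicate, run_append, run_append]
        obtain ⟨q, hq, hq', hqd⟩ := h.exists_next x (m + n - 1)
        have hqf : ∀ u, q ≤ u → u < q + n - 1 → adm false u := fun u hu hu' =>
          hfalse (q + n - 1) (by
            rw [hjn, show q + n - 1 - (m + n - 2) = q - (m + n - 1) + n by ring]
            exact dvd_add hqd dvd_rfl) u (by omega) hu'
        have hqt : ∀ u, x ≤ u → u < q → adm true u := fun u hu hu' =>
          htrue q hqd u (by omega) hu'
        by_cases hx : x = q - n + 1
        · have h1 : q - 1 ≤ run adm (List.replicate (n - 2) true) x :=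
            le_run_replicate le_rfl (fun u hu hu' => hqt u hu (by omega)) (by omega)
          have h3 := le_run (adm := adm) (List.replicate n false)
            (run adm (List.replicate (n - 2) true) x)
          have h5 := le_run (adm := adm) (List.replicate n (!false))
            (run adm (List.replicate n false) (run adm (List.replicate (n - 2) true) x) + 1)
          have h6 : q + n - 2 ≤ run adm (List.replicate (n - 2) (!true))
              (run adm (List.replicate n (!false))
                (run adm (List.replicate n false) (run adm (List.replicate (n - 2) true) x) + 1)) :=
            le_run_replicate (z := q) (by omega) (fun u hu hu' => hqf u hu (by omega)) (by omega)
          omega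
        · have h1 : q ≤ run adm (List.replicate (n - 2) true) x :=
            le_run_replicate le_rfl hqt (by omega)
          have h3 : q + n - 1 ≤ run adm (List.replicate n false)
              (run adm (List.replicate (n - 2) true) x) :=
            le_run_replicate h1 hqf (by omega)
          refine le_trans ?_ ((le_run _ _).trans (le_run _ _))
          omega
    · obtain ⟨i, hi⟩ : ∃ i : ℕ, j = m + i := ⟨(j - m).toNat, by omega⟩
      -- After crossing `j = m + i`, the last block can end at `m + n - 2` at most. From an
      -- arbitrary `x`, the same word followed by the extra step reaches a lift of the closing edge,
      -- where the inverse can cross.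
      refine ⟨List.replicate n false ++ true :: List.replicate (n - 3 - i) false, ?_, fun x => ?_⟩
      · rw [run_append, run_cons]
        have h1 := run_replicate_le hja hj n
        have h3 := step_le (adm := adm) true (run adm (List.replicate n false) m)
        refine (run_le_add_length _ _).trans ?_
        simp only [List.length_replicate]
        omega
      · rw [inv_append, inv_cons, inv_replicate, inv_replicate, run_append, run_append,
          run_append, run_cons]
        obtain ⟨s, hs, hs', hsd⟩ := h.exists_next x j
        have hst : adm true s :=
          (h.adm_congr hsd).2 (hP j hj hj')
        have h1 : s ≤ run adm (List.replicate n false) x :=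
          le_run_replicate le_rfl (fun u hu hu' => hfalse s hsd u (by omega) hu') (by omega)
        have h3 := lt_step hst h1
        have h5 : s + n - 2 - i ≤ run adm (List.replicate (n - 3 - i) false)
            (step adm true (run adm (List.replicate n false) x)) :=
          le_run_replicate h3 (fun u hu hu' => hfalse (s + n) (by
            rw [show s + n - j = s - j + n by ring]
            exact dvd_add hsd dvd_rfl) u (by omega) (by omega)) (by omega)
        have hqd : (n : ℤ) ∣ (s + n - 1 - i) - (m + n - 1) := by
          rwa [show s + n - 1 - i - (m + n - 1) = s - j by rw [hi]; ring]
        have h6 := le_run (adm := adm) (List.replicate (n - 3 - i) (!false))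
          (run adm (List.replicate (n - 3 - i) false)
            (step adm true (run adm (List.replicate n false) x)) + 1)
        have h7 := hcross _ hqd _ (le_trans (by omega) h6)
        simp only [Bool.not_true, run_cons, run_nil, Bool.not_false] at h7 ⊢
        omega

/-- Some edge blocks `b`, so by periodicity one does within any `n` consecutive edges; a block of
length `n` suffices to come to rest. -/
lemma not_adm_run_replicate (h : IsCover n adm) (hb : ∀ b, ∃ z, ¬ adm b z) (b : Bool) (z : ℤ) :
    ¬ adm b (run adm (List.replicate n b) z) := by
  obtain ⟨c, hc⟩ := hb b
  obtain ⟨q, hq, hq', hqd⟩ := h.exists_next z c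
  have hqa : ¬ adm b q := by rwa [h.adm_congr hqd]
  have key : ∀ (M : ℕ) (z : ℤ), q < z + M → z ≤ q →
      ¬ adm b (run adm (List.replicate M b) z) := by
    intro M
    induction M with
    | zero => intro z h1 h2; simp at h1; omega
    | succ M ih =>
      intro z h1 h2
      have h3 := run_replicate_le hqa h2 1
      by_cases hz : adm b z
      · have hs := step_pos hz
        simp only [List.replicate_succ, run_cons, List.replicate_zero, run_nil] at h3 ⊢
        rw [hs] at h3 ⊢
        exact ih _ (by push_cast at h1; omega) h3
      · have : run adm (List.replicate (M + 1) b) z = z :=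
          le_antisymm (run_replicate_le hz le_rfl _) (le_run _ _)
        rwa [this]
  exact key n z hq' hq

/-- After a block its letter is blocked, so the other letter is admitted and the next block moves.
-/
lemma run_alternating_lt (h : IsCover n adm) (hb : ∀ b, ∃ z, ¬ adm b z) (a : Bool) (z : ℤ)
    {i : ℕ} (hi : 1 ≤ i) :
    run adm (alternating n a i) z < run adm (alternating n a (i + 1)) z := by
  obtain ⟨i, rfl⟩ := Nat.exists_eq_add_of_le' hi
  have h4 := h.four_le
  rw [alternating_add a (i + 1) 1, run_append]
  set y := run adm (alternating n a (i + 1)) z with hy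
  have h1 : ¬ adm (letter a i) y := by
    rw [hy, alternating_add, run_append]
    simp only [alternating, List.append_nil]
    exact h.not_adm_run_replicate hb _ _
  have h2 : adm (letter a (i + 1)) y := by
    simp only [letter, letter_not]
    exact (h.total _ _).resolve_left h1
  simp only [alternating, List.append_nil]
  have : y + 1 ≤ run adm (List.replicate n (letter a (i + 1))) y :=
    le_run_replicate le_rfl (fun u hu hu' => by rwa [show u = y by omega]) (by omega)
  omega

/-- Take an alternating word with as many blocks as possible that still stops by `m + n - 2`. If it
failed to separate, some alternating orbit would be so slow that `2 * r - 1` blocks would also stop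
in time, against maximality of `r ≥ 2`. -/
lemma exists_separates_of_both (h : IsCover n adm) (m : ℤ)
    (hP : ∀ b, ∃ z, m ≤ z ∧ z ≤ m + n - 2 ∧ ¬ adm b z) : ∃ w, Separates n adm m w := by
  have h4 := h.four_le
  have hb : ∀ b, ∃ z, ¬ adm b z := fun b => (hP b).imp fun _ hz => hz.2.2
  let Q : ℕ → Prop := fun r => ∃ a, run adm (alternating n a r) m ≤ m + n - 2
  have hQ2 : Q 2 := by
    obtain ⟨y, hy, hy', hya⟩ := hP true
    obtain ⟨z, hz, hz', hza⟩ := hP false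
    have key : ∀ (b : Bool) (y z : ℤ), m ≤ y → y ≤ z → z ≤ m + n - 2 → ¬ adm b y →
        ¬ adm (!b) z → Q 2 := by
      intro b y z hy hyz hz hya hza
      refine ⟨b, ?_⟩
      simp only [alternating, List.append_nil, run_append]
      exact (run_replicate_le hza ((run_replicate_le hya hy n).trans hyz) n).trans hz
    rcases le_total y z with hyz | hyz
    · exact key true y z hy hyz hz' hya hza
    · exact key false z y hz hyz hy' hza hya
  have hgrow : ∀ (a : Bool) (z : ℤ) (i : ℕ), z + i ≤ run adm (alternating n a (i + 1)) z := by
    intro a z i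
    induction i with
    | zero => simpa using le_run _ _
    | succ i ih =>
      have := h.run_alternating_lt hb a z (i := i + 1) (by omega)
      push_cast
      omega
  have hQle : ∀ r, Q r → r ≤ n := by
    rintro r ⟨a, ha⟩
    rcases r with _ | r
    · omega
    · have := hgrow a m r
      omega
  classical
  obtain ⟨r, ⟨hr2, a, ha⟩, hmax⟩ : ∃ r, (2 ≤ r ∧ Q r) ∧ ∀ s, Q s → s ≤ r := by
    refine ⟨Nat.findGreatest Q n, ⟨Nat.le_findGreatest (hQle 2 hQ2) hQ2, ?_⟩, fun s hs => ?_⟩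
    · exact Nat.findGreatest_spec (hQle 2 hQ2) hQ2
    · exact Nat.le_findGreatest (hQle s hs) hs
  refine ⟨alternating n a r, ha, fun x => ?_⟩
  rw [inv_alternating]
  by_contra hlt
  -- the orbit of `x` under alternating blocks advances by less than `n` in `2 * r` blocks
  let t : ℕ → ℤ := fun i => run adm (alternating n a i) x
  have ht2 : t (2 * r) ≤ x + n := by
    have h1 : t (2 * r) = run adm (alternating n (letter a r) r)
        (run adm (alternating n a r) x) := by
      simp only [t]
      rw [two_mul, alternating_add, run_append]
    have h2 := run_mono (adm := adm) (alternating n (letter a r) r)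
      (show run adm (alternating n a r) x ≤ run adm (alternating n a r) x + 1 by omega)
    omega
  have hper : ∀ i, t (2 * r + i) ≤ t i + n := by
    intro i
    simp only [t]
    rw [alternating_add, run_append, letter_two_mul, ← h.run_add]
    exact run_mono _ ht2
  -- pass to the first point of the orbit beyond a far translate `N` of `m`
  obtain ⟨c, hc⟩ : ∃ c : ℕ, x < m + c * n := ⟨(x - m).toNat + 1, by
    push_cast
    nlinarith [Int.self_le_toNat (x - m)]⟩
  set N := m + c * n with hN
  have hex : ∃ i, N ≤ t i :=
    ⟨(N - x).toNat + 1, le_trans (by omega) (hgrow a x (N - x).toNat)⟩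
  obtain ⟨j, hj⟩ : ∃ j, Nat.find hex = j + 1 := by
    refine Nat.exists_eq_succ_of_ne_zero fun h0 => ?_
    have := Nat.find_spec hex
    rw [h0] at this
    simp only [t, alternating, run_nil] at this
    omega
  have hj1 : N ≤ t (j + 1) := hj ▸ Nat.find_spec hex
  have hj0 : t j < N := not_le.1 (Nat.find_min hex (by omega))
  -- The first block from `N` cannot pass `t (j + 1)`, where its letter is blocked; monotonicity
  -- then keeps the run below the orbit. Finally `t (j + 2 * r - 1) < t (j + 2 * r) ≤ t j + n < N +
  -- n` gives the bound `N + n - 2`.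
  have hQ : Q (2 * r - 1) := by
    refine ⟨letter a j, ?_⟩
    have h1 : run adm (alternating n (letter a j) (2 * r - 1)) N ≤ t (j + 2 * r - 1) := by
      obtain ⟨s, hs⟩ : ∃ s, 2 * r - 1 = 1 + s := ⟨2 * r - 2, by omega⟩
      have hjs : j + 2 * r - 1 = (j + 1) + s := by omega
      have hblocked : ¬ adm (letter a j) (t (j + 1)) := by
        simp only [t]
        rw [alternating_add, run_append]
        simp only [alternating, List.append_nil]
        exact h.not_adm_run_replicate hb _ _
      have hlet1 : letter (letter a j) 1 = letter a (j + 1) := by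
        simp only [letter, letter_not]
      simp only [hs, hjs, t]
      rw [alternating_add, alternating_add a (j + 1), run_append, run_append, hlet1]
      refine run_mono _ ?_
      simp only [alternating, List.append_nil]
      exact run_replicate_le hblocked hj1 n
    have h2 : t (j + 2 * r - 1) < t (j + 2 * r) := by
      have := h.run_alternating_lt hb a x (i := j + 2 * r - 1) (by omega)
      rwa [show j + 2 * r - 1 + 1 = j + 2 * r by omega] at this
    have h3 := hper j
    rw [add_comm (2 * r) j] at h3
    rw [hN, h.run_add_mul] at h1
    omega
  have := hmax _ hQ
  omega

lemma exists_separates (h : IsCover n adm) (m : ℤ) : ∃ w, Separates n adm m w := by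
  have h4 := h.four_le
  have of_flip : (∃ w, Separates n (fun b => adm (!b)) m w) → ∃ w, Separates n adm m w :=
    fun ⟨w, hw⟩ => ⟨_, hw.of_flip⟩
  by_cases ht : ∀ z, adm true z
  · exact h.exists_separates_of_forall_adm m ht
  by_cases hf : ∀ z, adm false z
  · exact of_flip (h.flip.exists_separates_of_forall_adm m hf)
  push Not at ht hf
  have hclosing : ∀ b, (∃ z, ¬ adm b z) → (∀ z, m ≤ z → z ≤ m + n - 2 → adm b z) →
      ¬ adm b (m + n - 1) := by
    rintro b ⟨z, hz⟩ hall
    obtain ⟨q, hq, hq', hqd⟩ := h.exists_next m z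
    rw [← h.adm_congr hqd] at hz
    by_cases hqe : q = m + n - 1
    · rwa [← hqe]
    · exact absurd (hall q hq (by omega)) hz
  by_cases hPt : ∀ z, m ≤ z → z ≤ m + n - 2 → adm true z
  · exact h.exists_separates_of_closing m hPt (hclosing true ht hPt) hf
  by_cases hPf : ∀ z, m ≤ z → z ≤ m + n - 2 → adm false z
  · exact of_flip (h.flip.exists_separates_of_closing m hPf (hclosing false hf hPf) ht)
  push Not at hPt hPf
  refine h.exists_separates_of_both m fun b => ?_
  cases b
  · exact hPf
  · exact hPt

end IsCover

/-! ### Walks reading a word -/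

section Walk

/-- There is a walk from `x` to `y` reading the word `w`, where `true` is read along an arc and
`false` against one. -/
def Walk {V : Type*} (A : V → V → Prop) : List Bool → V → V → Prop
  | [], x, y => x = y
  | b :: w, x, y => ∃ z, (if b then A x z else A z x) ∧ Walk A w z y

variable {V W : Type*} {A : V → V → Prop}

lemma Walk.append {v w : List Bool} {x y z : V} (h : Walk A v x y) (h' : Walk A w y z) :
    Walk A (v ++ w) x z := by
  induction v generalizing x with
  | nil => cases h; exact h'
  | cons b v ih =>
    obtain ⟨u, hu, h⟩ := h
    exact ⟨u, hu, ih h⟩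

lemma Walk.reverse {w : List Bool} {x y : V} (h : Walk A w x y) : Walk A (inv w) y x := by
  induction w generalizing x with
  | nil => exact h.symm
  | cons b w ih =>
    obtain ⟨u, hu, h⟩ := h
    rw [inv_cons]
    refine (ih h).append ⟨x, ?_, rfl⟩
    cases b <;> simpa using hu

lemma Walk.map {B : W → W → Prop} {f : V → W} (hf : ∀ x y, A x y → B (f x) (f y))
    {w : List Bool} {x y : V} (h : Walk A w x y) : Walk B w (f x) (f y) := by
  induction w generalizing x with
  | nil => exact congrArg f h
  | cons b w ih =>
    obtain ⟨u, hu, h⟩ := h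
    refine ⟨f u, ?_, ih h⟩
    cases b
    · simpa using hf _ _ (by simpa using hu)
    · simpa using hf _ _ (by simpa using hu)

lemma Walk.pi {ι : Type*} {w : List Bool} {x y : ι → V} (h : ∀ i, Walk A w (x i) (y i)) :
    Walk (fun x y : ι → V => ∀ i, A (x i) (y i)) w x y := by
  induction w generalizing x with
  | nil => exact funext h
  | cons b w ih =>
    choose u hu h using h
    refine ⟨u, ?_, ih h⟩
    cases b <;> simpa using hu

lemma inv_inv (w : List Bool) : inv (inv w) = w := by
  simp [inv, Function.comp_def]

end Walk

/-! ### The universal cover of the cycle -/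

/-- The covering map from `ℤ` to the vertices of an `n`-cycle. -/
def proj {n : ℕ} (hn : 4 ≤ n) (z : ℤ) : Fin n :=
  ⟨(z % n).toNat, by
    have := Int.emod_nonneg z (show (n : ℤ) ≠ 0 by omega)
    have := Int.emod_lt_of_pos z (show (0 : ℤ) < n by omega)
    omega⟩

/-- The arcs of the universal cover of the cycle `G`. -/
def Arc {n : ℕ} (hn : 4 ≤ n) (G : Digraph (Fin n)) (y z : ℤ) : Prop :=
  |y - z| ≤ 1 ∧ G.Adj (proj hn y) (proj hn z)

/-- The edges of the universal cover of `G` that can be crossed to the right. -/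
def coverAdm {n : ℕ} (hn : 4 ≤ n) (G : Digraph (Fin n)) (b : Bool) (z : ℤ) : Prop :=
  if b then Arc hn G z (z + 1) else Arc hn G (z + 1) z

section Cover

variable {n : ℕ} {hn : 4 ≤ n} {G : Digraph (Fin n)}

lemma proj_val (z : ℤ) : ((proj hn z : ℕ) : ℤ) = z % n := by
  have := Int.emod_nonneg z (show (n : ℤ) ≠ 0 by omega)
  simp only [proj]
  omega

lemma proj_eq_iff {y z : ℤ} : proj hn y = proj hn z ↔ (n : ℤ) ∣ y - z := by
  rw [Fin.ext_iff, ← Int.natCast_inj, proj_val, proj_val]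
  exact eq_comm.trans Int.modEq_iff_dvd

lemma proj_natCast (u : Fin n) : proj hn ((u : ℕ) : ℤ) = u := by
  rw [Fin.ext_iff, ← Int.natCast_inj, proj_val]
  exact Int.emod_eq_of_lt (by omega) (by have := u.2; omega)

lemma isNext_proj (z : ℤ) : IsNext (proj hn z) (proj hn (z + 1)) := by
  have h1 := proj_val (hn := hn) z
  have h2 := proj_val (hn := hn) (z + 1)
  have h3 := Int.emod_lt_of_pos z (show (0 : ℤ) < n by omega)
  have h0 := Int.emod_nonneg z (show (n : ℤ) ≠ 0 by omega)
  unfold IsNext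
  by_cases h : z % n + 1 = n
  · right
    have : (z + 1) % n = 0 := by
      rw [Int.add_emod, Int.emod_eq_of_lt (a := 1) (by omega) (by omega), h, Int.emod_self]
    omega
  · left
    have : (z + 1) % n = z % n + 1 := by
      rw [Int.add_emod, Int.emod_eq_of_lt (a := 1) (by omega) (by omega)]
      exact Int.emod_eq_of_lt (by omega) (by omega)
    omega

lemma IsNext.dvd {y z : ℤ} (h : IsNext (proj hn y) (proj hn z)) : (n : ℤ) ∣ z - y - 1 := by
  rw [sub_sub, ← proj_eq_iff (hn := hn)]
  have h' := isNext_proj (hn := hn) y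
  have := (proj hn (y + 1)).2
  have := (proj hn z).2
  unfold IsNext at h h'
  rw [Fin.ext_iff]
  omega

lemma IsReflexiveCycle.exists_near (hG : IsReflexiveCycle G) {y z : ℤ}
    (h : G.Adj (proj hn y) (proj hn z) ∨ G.Adj (proj hn z) (proj hn y)) :
    ∃ e : ℤ, |e| ≤ 1 ∧ (n : ℤ) ∣ z - y - e := by
  have key : proj hn y = proj hn z ∨ IsNext (proj hn y) (proj hn z) ∨
      IsNext (proj hn z) (proj hn y) := by
    rcases h with h | h
    · exact hG.only _ _ h
    · rcases hG.only _ _ h with h | h | h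
      · exact Or.inl h.symm
      · exact Or.inr (Or.inr h)
      · exact Or.inr (Or.inl h)
  rcases key with h | h | h
  · exact ⟨0, by simp, by simpa using proj_eq_iff.1 h.symm⟩
  · exact ⟨1, by simp, h.dvd⟩
  · refine ⟨-1, by simp, ?_⟩
    rw [← dvd_neg]
    simpa [sub_eq_add_neg, add_comm, add_left_comm] using h.dvd

/-- In the universal cover, images of triangles are degenerate. -/
lemma IsReflexiveCycle.abs_sub_le_one (hG : IsReflexiveCycle G) {x y z : ℤ}
    (hxy : |x - y| ≤ 1) (hyz : |y - z| ≤ 1)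
    (h : G.Adj (proj hn x) (proj hn z) ∨ G.Adj (proj hn z) (proj hn x)) : |x - z| ≤ 1 := by
  obtain ⟨e, he, c, hc⟩ := hG.exists_near h
  rw [abs_le] at *
  -- The multiple `n * c` has absolute value at most 3; this is where `n ≥ 4` excludes winding
  -- triangles.
  have hc0 : c = 0 := by
    have h1 : -4 < (n : ℤ) * c := by omega
    have h2 : (n : ℤ) * c < 4 := by omega
    have h3 : (4 : ℤ) ≤ n := by omega
    have : -1 < c := by nlinarith
    have : c < 1 := by nlinarith
    omega
  subst hc0
  simp only [mul_zero] at hc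
  omega

lemma IsReflexiveCycle.arc_refl (hG : IsReflexiveCycle G) (z : ℤ) : Arc hn G z z :=
  ⟨by simp, hG.refl _⟩

lemma IsReflexiveCycle.arc_succ (hG : IsReflexiveCycle G) (z : ℤ) :
    Arc hn G z (z + 1) ∨ Arc hn G (z + 1) z :=
  (hG.edge _ _ (isNext_proj z)).imp (fun h => ⟨by simp, h⟩) (fun h => ⟨by simp, h⟩)

lemma IsReflexiveCycle.isCover (hG : IsReflexiveCycle G) : IsCover n (coverAdm hn G) where
  four_le := hn
  periodic b z := by
    have h1 : proj hn (z + n) = proj hn z := proj_eq_iff.2 (by simp)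
    have h2 : proj hn (z + n + 1) = proj hn (z + 1) := proj_eq_iff.2 (by
      rw [show z + n + 1 - (z + 1) = n by ring])
    simp [coverAdm, Arc, h1, h2]
  total b z := by
    have := hG.arc_succ (hn := hn) z
    cases b <;> simp only [coverAdm] <;> simp <;> tauto

/-- Loops allow idling, so all positions up to the greedy one are reachable. -/
lemma walk_of_le_run (hG : IsReflexiveCycle G) {w : List Bool} {x y : ℤ} (hxy : x ≤ y)
    (hy : y ≤ run (coverAdm hn G) w x) : Walk (Arc hn G) w x y := by
  induction w generalizing x with
  | nil => exact le_antisymm hxy hy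
  | cons b w ih =>
    by_cases hs : step (coverAdm hn G) b x ≤ y
    · refine ⟨step (coverAdm hn G) b x, ?_, ih hs hy⟩
      by_cases ha : coverAdm hn G b x
      · rw [step_pos ha]
        exact ha
      · rw [step_neg ha]
        cases b <;> simpa using hG.arc_refl x
    · have := step_le (adm := coverAdm hn G) b x
      obtain rfl : y = x := by omega
      refine ⟨y, ?_, ih le_rfl (le_run _ _)⟩
      cases b <;> simpa using hG.arc_refl y

lemma Walk.le_run {w : List Bool} {x y : ℤ} (h : Walk (Arc hn G) w x y) :
    y ≤ run (coverAdm hn G) w x := by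
  induction w generalizing x with
  | nil => exact h.ge
  | cons b w ih =>
    obtain ⟨u, hu, h⟩ := h
    refine (ih h).trans (run_mono w ?_)
    have hux : u ≤ x + 1 := by
      cases b
      · have := hu.1; rw [abs_le] at this; omega
      · have := hu.1; rw [abs_le] at this; omega
    rcases hux.eq_or_lt with rfl | hlt
    · rw [step_pos hu]
    · exact (Int.lt_add_one_iff.1 hlt).trans (le_step _ _)

/-- Targets up to `run w x` are reached rightward from `x`. The remaining ones before `x + n` are
reached leftward from `x + n`, by reversing a walk that reads `inv w`. -/
lemma Separates.exists_walk (hG : IsReflexiveCycle G) {m : ℤ} {w : List Bool}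
    (hw : Separates n (coverAdm hn G) m w) (x y : ℤ) :
    ∃ x' y', (n : ℤ) ∣ x' - x ∧ (n : ℤ) ∣ y' - y ∧ Walk (Arc hn G) w x' y' := by
  obtain ⟨y', hxy, hyx, hd⟩ := (hG.isCover (hn := hn)).exists_next x y
  by_cases hy : y' ≤ run (coverAdm hn G) w x
  · exact ⟨x, y', by simp, hd, walk_of_le_run hG hxy hy⟩
  · have h1 := hw.2 x
    have h2 := run_mono (adm := coverAdm hn G) (inv w)
      (show run (coverAdm hn G) w x + 1 ≤ y' by omega)
    have h3 := (walk_of_le_run hG hyx.le (h1.trans h2)).reverse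
    rw [inv_inv] at h3
    exact ⟨x + n, y', by simp, hd, h3⟩

end Cover

/-! ### Lifting homomorphisms to the cover -/

section Lift

variable {n : ℕ} {hn : 4 ≤ n} {G : Digraph (Fin n)}

lemma exists_antiderivative (s : ℤ → ℤ) (a : ℤ) :
    ∃ L : ℤ → ℤ, L 0 = a ∧ ∀ t, L (t + 1) = L t + s t := by
  refine ⟨fun t => a + ∑ i ∈ Finset.Ico 0 t, s i - ∑ i ∈ Finset.Ico t 0, s i, by simp,
    fun t => ?_⟩
  beta_reduce
  rcases lt_or_ge t 0 with ht | ht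
  · have h1 : Finset.Ico t 0 = insert t (Finset.Ico (t + 1) 0) := by
      ext i; simp only [Finset.mem_insert, Finset.mem_Ico]; omega
    rw [h1, Finset.sum_insert (by simp), Finset.Ico_eq_empty_of_le ht.le,
      Finset.Ico_eq_empty_of_le (show t + 1 ≤ 0 by omega)]
    ring
  · have h1 : Finset.Ico 0 (t + 1) = insert t (Finset.Ico 0 t) := by
      ext i; simp only [Finset.mem_insert, Finset.mem_Ico]; omega
    rw [h1, Finset.sum_insert (by simp), Finset.Ico_eq_empty_of_le ht,
      Finset.Ico_eq_empty_of_le (show 0 ≤ t + 1 by omega)]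
    ring

lemma exists_path_lift (hG : IsReflexiveCycle G) (p : ℤ → Fin n)
    (hp : ∀ t, G.Adj (p t) (p (t + 1)) ∨ G.Adj (p (t + 1)) (p t)) (a : ℤ)
    (ha : proj hn a = p 0) :
    ∃ L : ℤ → ℤ, L 0 = a ∧ (∀ t, proj hn (L t) = p t) ∧ ∀ t, |L t - L (t + 1)| ≤ 1 := by
  have hs : ∀ t, ∃ e : ℤ, |e| ≤ 1 ∧ (n : ℤ) ∣ ((p (t + 1) : ℕ) : ℤ) - ((p t : ℕ) : ℤ) - e :=
    fun t => hG.exists_near (hn := hn) (by simpa only [proj_natCast] using hp t)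
  choose s hs1 hsd using hs
  obtain ⟨L, hL0, hL⟩ := exists_antiderivative s a
  have key : ∀ t, (n : ℤ) ∣ L t - ((p t : ℕ) : ℤ) := by
    intro t
    induction t using Int.induction_on with
    | zero => rw [← proj_eq_iff (hn := hn), proj_natCast, hL0, ha]
    | succ t ih =>
      obtain ⟨c, hc⟩ := dvd_sub ih (hsd t)
      exact ⟨c, by rw [hL, ← hc]; ring⟩
    | pred t ih =>
      have h1 := hsd (-(t : ℤ) - 1)
      have h2 := hL (-(t : ℤ) - 1)
      rw [sub_add_cancel] at h1 h2
      obtain ⟨c, hc⟩ := dvd_add ih h1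
      exact ⟨c, by rw [← hc, h2]; ring⟩
  refine ⟨L, hL0, fun t => ?_, fun t => ?_⟩
  · rw [← proj_natCast (hn := hn) (p t)]
    exact proj_eq_iff.2 (key t)
  · rw [hL, abs_sub_comm]
    simpa using hs1 t

/-- Every homomorphism from a power of the universal cover to the cycle lifts to the universal
cover. -/
lemma exists_lift (hG : IsReflexiveCycle G) (k : ℕ) (f : (Fin k → ℤ) → Fin n)
    (hf : ∀ x y, (∀ i, Arc hn G (x i) (y i)) → G.Adj (f x) (f y)) :
    ∃ F : (Fin k → ℤ) → ℤ, (∀ x, proj hn (F x) = f x) ∧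
      ∀ x y, (∀ i, Arc hn G (x i) (y i)) → |F x - F y| ≤ 1 := by
  induction k with
  | zero =>
    exact ⟨fun x => ((f x : ℕ) : ℤ), fun x => proj_natCast _, fun x y _ => by
      rw [Subsingleton.elim x y]; simp⟩
  | succ k ih =>
    have hcons : ∀ {s t : ℤ} {x y : Fin k → ℤ}, Arc hn G s t → (∀ i, Arc hn G (x i) (y i)) →
        G.Adj (f (Fin.cons s x)) (f (Fin.cons t y)) := fun hst hxy =>
      hf _ _ (Fin.cases (by simpa using hst) (by simpa using hxy))
    have hrefl : ∀ (x : Fin k → ℤ) (i : Fin k), Arc hn G (x i) (x i) := fun x i => hG.arc_refl _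
    obtain ⟨F₀, hF₀, hF₀'⟩ := ih (fun x => f (Fin.cons 0 x))
      (fun x y hxy => hcons (hG.arc_refl 0) hxy)
    have hL : ∀ x : Fin k → ℤ, ∃ L : ℤ → ℤ, L 0 = F₀ x ∧
        (∀ t, proj hn (L t) = f (Fin.cons t x)) ∧ ∀ t, |L t - L (t + 1)| ≤ 1 := fun x =>
      exists_path_lift hG (fun t => f (Fin.cons t x))
        (fun t => (hG.arc_succ (hn := hn) t).imp (fun h => hcons h (hrefl x))
          (fun h => hcons h (hrefl x))) _ (hF₀ x)
    choose L hL0 hLf hLs using hL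
    -- The diagonal of the square with corners `L x s`, `L x t`, `L y s`, `L y t` cuts it into two
    -- triangles, so closeness passes from level `s` to level `t`.
    have hstep : ∀ {x y : Fin k → ℤ} {s t : ℤ}, (∀ i, Arc hn G (x i) (y i)) →
        |s - t| ≤ 1 → |L x s - L y s| ≤ 1 → |L x t - L y t| ≤ 1 := by
      intro x y s t hxy hst h
      have hline : ∀ x, |L x s - L x t| ≤ 1 := by
        intro x
        rw [abs_le] at hst
        obtain rfl | rfl | rfl : t = s ∨ t = s + 1 ∨ s = t + 1 := by omega
        · simp
        · exact hLs x s
        · rw [abs_sub_comm]; exact hLs x t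
      have harc : Arc hn G s t ∨ Arc hn G t s := by
        rw [abs_le] at hst
        obtain rfl | rfl | rfl : t = s ∨ t = s + 1 ∨ s = t + 1 := by omega
        · exact Or.inl (hG.arc_refl _)
        · exact hG.arc_succ s
        · exact (hG.arc_succ t).symm
      have hxyt : G.Adj (proj hn (L x t)) (proj hn (L y t)) := by
        simpa only [hLf] using hcons (hG.arc_refl t) hxy
      rcases harc with ha | ha
      · have h1 : |L x s - L y t| ≤ 1 := hG.abs_sub_le_one (hn := hn) h (hline y)
          (Or.inl (by simpa only [hLf] using hcons ha hxy))
        exact hG.abs_sub_le_one (by rw [abs_sub_comm]; exact hline x) h1 (Or.inl hxyt)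
      · have h1 : |L x t - L y s| ≤ 1 := hG.abs_sub_le_one (hn := hn)
          (by rw [abs_sub_comm]; exact hline x) h
          (Or.inl (by simpa only [hLf] using hcons ha hxy))
        exact hG.abs_sub_le_one h1 (hline y) (Or.inl hxyt)
    have hlevel : ∀ {x y : Fin k → ℤ}, (∀ i, Arc hn G (x i) (y i)) →
        ∀ t, |L x t - L y t| ≤ 1 := by
      intro x y hxy t
      induction t using Int.induction_on with
      | zero => rw [hL0, hL0]; exact hF₀' x y hxy
      | succ t ih => exact hstep hxy (by simp) ih
      | pred t ih => exact hstep hxy (by simp) ih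
    refine ⟨fun x => L (Fin.tail x) (x 0), fun x => ?_, fun x y hxy => ?_⟩
    · rw [hLf, Fin.cons_self_tail]
    · have hline : |L (Fin.tail x) (x 0) - L (Fin.tail x) (y 0)| ≤ 1 := by
        have hst := (hxy 0).1
        rw [abs_le] at hst
        obtain h | h | h : y 0 = x 0 ∨ y 0 = x 0 + 1 ∨ x 0 = y 0 + 1 := by omega
        · simp [h]
        · rw [h]; exact hLs _ _
        · rw [h, abs_sub_comm]; exact hLs _ _
      refine hG.abs_sub_le_one (hn := hn) hline (hlevel (fun i => hxy i.succ) _) (Or.inl ?_)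
      simpa only [hLf, Fin.cons_self_tail] using hf x y hxy

end Lift

/-! ### Winding numbers and unit speed -/

lemma periodic_of_single {ι α : Type*} [Fintype ι] [DecidableEq ι] {D : (ι → ℤ) → α}
    {v : ι → ℤ} (h : ∀ i, Function.Periodic D (Pi.single i (v i))) : Function.Periodic D v := by
  rw [← Finset.univ_sum_single v]
  induction (Finset.univ : Finset ι) using Finset.induction_on with
  | empty => intro z; simp
  | insert i s hi ih =>
    rw [Finset.sum_insert hi]
    exact (h i).add_period ih

lemma abs_sub_add_le {p : ℤ → ℤ} (hp : ∀ t, |p (t + 1) - p t| ≤ 1) (t : ℤ) (j : ℕ) :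
    |p (t + j) - p t| ≤ j := by
  induction j with
  | zero => simp
  | succ j ih =>
    have := hp (t + j)
    rw [abs_le] at *
    push_cast
    rw [← add_assoc]
    omega

section Winding

variable {n : ℕ} {hn : 4 ≤ n} {G : Digraph (Fin n)} {k : ℕ} {F : (Fin k → ℤ) → ℤ}

lemma arc_add_single (hG : IsReflexiveCycle G) (z : Fin k → ℤ) (i : Fin k) :
    (∀ j, Arc hn G (z j) ((z + Pi.single i 1 : Fin k → ℤ) j)) ∨
      ∀ j, Arc hn G ((z + Pi.single i 1 : Fin k → ℤ) j) (z j) := by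
  refine (hG.arc_succ (hn := hn) (z i)).imp (fun h j => ?_) (fun h j => ?_) <;>
  · by_cases hj : j = i
    · subst hj; simpa using h
    · simpa [hj] using hG.arc_refl (z j)

lemma abs_sub_add_single_le (hG : IsReflexiveCycle G)
    (hF : ∀ x y, (∀ i, Arc hn G (x i) (y i)) → Arc hn G (F x) (F y)) (z : Fin k → ℤ)
    (i : Fin k) : |F (z + Pi.single i 1) - F z| ≤ 1 := by
  rcases arc_add_single (hn := hn) hG z i with h | h
  · rw [abs_sub_comm]; exact (hF _ _ h).1
  · exact (hF _ _ h).1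

/-- If `F` moves at unit speed along a coordinate, it is constant in every other direction. -/
lemma eq_of_unit_speed (hG : IsReflexiveCycle G)
    (hF : ∀ x y, (∀ i, Arc hn G (x i) (y i)) → Arc hn G (F x) (F y)) {i : Fin k} {w : ℤ}
    (hw : w * w = 1) (hFw : ∀ z, F (z + Pi.single i 1) = F z + w) {x y : Fin k → ℤ}
    (hxy : ∀ j, Arc hn G (x j) (y j)) (hi : x i = y i) : F x = F y := by
  have hline : ∀ z (t : ℤ), F (z + Pi.single i t) = F z + t * w := by
    intro z t
    induction t using Int.induction_on with
    | zero => simp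
    | succ t ih =>
      rw [Pi.single_add, ← add_assoc, hFw, ih]; ring
    | pred t ih =>
      have := hFw (z + Pi.single i (-(t : ℤ) - 1))
      rw [add_assoc, ← Pi.single_add, sub_add_cancel, ih] at this
      linarith
  obtain ⟨e, he⟩ : ∃ e, F y = F x + e := ⟨F y - F x, by ring⟩
  have hshift : ∀ s t : ℤ, Arc hn G (x i + s) (y i + t) → Arc hn G (F x + s * w) (F y + t * w) := by
    intro s t hst
    rw [← hline, ← hline]
    refine hF _ _ fun j => ?_
    by_cases hj : j = i
    · subst hj; simpa using hst
    · simpa [hj] using hxy j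
  have he1 : |e| ≤ 1 := by
    have := (hF x y hxy).1
    rwa [he, sub_add_cancel_left, abs_neg] at this
  have harc : ∀ u, Arc hn G u (u + e) := by
    intro u
    have := hshift (w * (u - F x)) (w * (u - F x)) (by rw [hi]; exact hG.arc_refl _)
    rw [he] at this
    convert this using 1
    · linear_combination (F x - u) * hw
    · linear_combination (F x - u) * hw
  have hline' : ∀ s t : ℤ, Arc hn G (x i + s) (x i + t) →
      Arc hn G (F x + s * w) (F x + t * w) := by
    intro s t hst
    rw [← hline, ← hline]
    refine hF _ _ fun j => ?_
    by_cases hj : j = i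
    · subst hj; simpa using hst
    · simpa [hj] using hG.arc_refl (x j)
  -- Feeding the arcs of `harc` back through `F` along coordinate `i` multiplies the displacement by
  -- `w`. Shifting `y` by `e * w` then makes `F` jump by `2 * e`, which forces `e = 0`.
  have harc' : ∀ u, Arc hn G u (u + e * w) := by
    intro u
    have := hline' (w * (u - F x)) (w * (u - F x) + e) (by rw [← add_assoc]; exact harc _)
    convert this using 1
    · linear_combination (F x - u) * hw
    · linear_combination (F x - u) * hw
  have h2 := (hshift 0 (e * w) (by rw [add_zero, hi]; exact harc' _)).1
  rw [he, mul_assoc, hw] at h2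
  rw [abs_le] at h2
  omega

lemma exists_winding (hG : IsReflexiveCycle G)
    (hF : ∀ x y, (∀ i, Arc hn G (x i) (y i)) → Arc hn G (F x) (F y))
    (hper : ∀ x y, (∀ i, (n : ℤ) ∣ x i - y i) → (n : ℤ) ∣ F x - F y) (i : Fin k) :
    Function.Periodic F (Pi.single i (n : ℤ)) ∨
      ∃ w : ℤ, w * w = 1 ∧ ∀ z, F (z + Pi.single i 1) = F z + w := by
  let D : (Fin k → ℤ) → ℤ := fun z => F (z + Pi.single i (n : ℤ)) - F z
  have hDd : ∀ z, (n : ℤ) ∣ D z := fun z => hper _ _ fun j => by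
    by_cases hj : j = i
    · subst hj; simp
    · simp [hj]
  -- A unit step changes `D` by at most 2, but `D` takes values in the multiples of `n ≥ 4`.
  have hDp : ∀ v, Function.Periodic D v := fun v => periodic_of_single fun j => by
    have h1 : Function.Periodic D (Pi.single j 1) := by
      intro z
      have h2 := abs_sub_add_single_le hG hF z j
      have h3 := abs_sub_add_single_le hG hF (z + Pi.single i (n : ℤ)) j
      obtain ⟨c, hc⟩ := dvd_sub (hDd (z + Pi.single j 1)) (hDd z)
      simp only [D] at hc ⊢
      rw [add_right_comm] at h3
      rw [abs_le] at h2 h3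
      have hc0 : c = 0 := by
        have h5 : -4 < (n : ℤ) * c := by omega
        have h6 : (n : ℤ) * c < 4 := by omega
        have h7 : (4 : ℤ) ≤ n := by omega
        have : -1 < c := by nlinarith
        have : c < 1 := by nlinarith
        omega
      subst hc0
      simp only [mul_zero] at hc
      omega
    have := h1.zsmul (v j)
    rwa [← Pi.single_smul', smul_eq_mul, mul_one] at this
  have hD : ∀ z, D z = D 0 := fun z => by simpa using hDp z 0
  obtain ⟨w, hw⟩ := hDd 0
  have hwin : ∀ z, F (z + Pi.single i (n : ℤ)) = F z + n * w := fun z => by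
    have := hD z
    rw [hw] at this
    simp only [D] at this
    linarith
  have hbound : ∀ z (j : ℕ), |F (z + Pi.single i (j : ℤ)) - F z| ≤ j := by
    intro z j
    have := abs_sub_add_le (p := fun t => F (z + Pi.single i t))
      (fun t => by
        rw [Pi.single_add, ← add_assoc]
        exact abs_sub_add_single_le hG hF _ _) 0 j
    simpa using this
  have hw1 : |w| ≤ 1 := by
    have := hbound 0 n
    rw [hwin, add_sub_cancel_left, abs_mul, Nat.abs_cast] at this
    have h7 : (4 : ℤ) ≤ n := by omega
    by_contra hlt
    nlinarith
  have hcase : w = 0 ∨ w = 1 ∨ w = -1 := by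
    rw [abs_le] at hw1; omega
  rcases hcase with rfl | hw'
  · left
    intro z
    simpa using hwin z
  · right
    refine ⟨w, by rcases hw' with rfl | rfl <;> rfl, fun z => ?_⟩
    -- A total displacement of `n` in `n` steps of size at most 1 leaves no slack in any step.
    have h1 := hbound (z + Pi.single i 1) (n - 1)
    rw [add_assoc, ← Pi.single_add, show (1 : ℤ) + ((n - 1 : ℕ) : ℤ) = n by omega, hwin] at h1
    have h2 := abs_sub_add_single_le hG hF z i
    rw [abs_le] at h1 h2
    rcases hw' with rfl | rfl <;> omega

end Winding

end ReflexiveCycle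

/-! ### The two cases combined -/

open ReflexiveCycle in
theorem theorem1p1 (n : ℕ) (hn : 4 ≤ n) (G : Digraph (Fin n))
    (hG : ReflexiveCycle.IsReflexiveCycle G) : ReflexiveCycle.IsSlupecki G := by
  intro k hk f hf hsurj
  have hadj : ∀ x y : Fin k → ℤ, (∀ i, Arc hn G (x i) (y i)) →
      G.Adj (f (proj hn ∘ x)) (f (proj hn ∘ y)) := fun x y h => hf fun i => (h i).2
  obtain ⟨F, hFf, hF1⟩ := exists_lift hG k (fun x => f (proj hn ∘ x)) hadj
  have hF : ∀ x y, (∀ i, Arc hn G (x i) (y i)) → Arc hn G (F x) (F y) := fun x y h =>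
    ⟨hF1 x y h, by rw [hFf, hFf]; exact hadj x y h⟩
  have hper : ∀ x y, (∀ i, (n : ℤ) ∣ x i - y i) → (n : ℤ) ∣ F x - F y := by
    intro x y h
    rw [← proj_eq_iff (hn := hn), hFf, hFf]
    congr 1
    exact funext fun i => proj_eq_iff.2 (h i)
  have hlift : ∀ x : Fin k → Fin n, proj hn (F fun i => ((x i : ℕ) : ℤ)) = f x := fun x => by
    rw [hFf]
    congr 1
    exact funext fun i => proj_natCast _
  by_cases hw : ∃ i, ∃ w : ℤ, w * w = 1 ∧ ∀ z, F (z + Pi.single i 1) = F z + w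
  · obtain ⟨i, w, hw, hFw⟩ := hw
    -- The diagonal of `f` serves as the endomorphism: all coordinates other than `i` may be set to
    -- `x i`.
    refine ⟨i, fun t => f fun _ => t, fun s t hst => hf fun _ => hst, fun x => ?_⟩
    have hstep : ∀ j, j ≠ i → Function.Periodic F (Pi.single j (1 : ℤ)) := by
      intro j hj z
      have hi : (z + Pi.single j (1 : ℤ) : Fin k → ℤ) i = z i := by simp [hj.symm]
      rcases arc_add_single (hn := hn) hG z j with h | h
      · exact (eq_of_unit_speed hG hF hw hFw h hi.symm).symm
      · exact eq_of_unit_speed hG hF hw hFw h hi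
    have key : Function.Periodic F (fun j => ((x i : ℕ) : ℤ) - ((x j : ℕ) : ℤ)) := by
      refine periodic_of_single fun j => ?_
      by_cases hj : j = i
      · subst hj
        intro z
        simp
      · have := (hstep j hj).zsmul (((x i : ℕ) : ℤ) - ((x j : ℕ) : ℤ))
        rwa [← Pi.single_smul', smul_eq_mul, mul_one] at this
    have := key fun j => ((x j : ℕ) : ℤ)
    change f x = f fun _ => x i
    rw [← hlift x, ← hlift fun _ => x i, ← this]
    congr 2
    ext j
    simp
  · exfalso
    push Not at hw
    have hFper : ∀ x y, (∀ i, (n : ℤ) ∣ x i - y i) → F x = F y := by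
      intro x y h
      have : Function.Periodic F (x - y) := by
        refine periodic_of_single fun i => ?_
        rcases exists_winding hG hF hper i with hp | ⟨w, hw1, hw2⟩
        · obtain ⟨c, hc⟩ := h i
          have := hp.zsmul c
          rwa [← Pi.single_smul', smul_eq_mul, mul_comm, ← hc] at this
        · obtain ⟨z, hz⟩ := hw i w hw1
          exact absurd (hw2 z) hz
      simpa using this y
    have : NeZero n := ⟨by omega⟩
    obtain ⟨x, hx⟩ := Finite.exists_min
      fun x : Fin k → Fin n => F fun i => ((x i : ℕ) : ℤ)
    obtain ⟨y, hy⟩ := hsurj (proj hn ((F fun i => ((x i : ℕ) : ℤ)) - 1))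
    have hxy := hx y
    rw [← hlift y, proj_eq_iff] at hy
    obtain ⟨w, hsep⟩ := (hG.isCover (hn := hn)).exists_separates (F fun i => ((x i : ℕ) : ℤ))
    choose x' y' hx' hy' hwalk using fun i =>
      hsep.exists_walk hG ((x i : ℕ) : ℤ) ((y i : ℕ) : ℤ)
    have h1 := ((Walk.pi hwalk).map hF).le_run
    rw [hFper x' _ hx', hFper y' _ hy'] at h1
    have h2 := hsep.1
    obtain ⟨c, hc⟩ := hy
    -- Minimality of the value at `x` excludes `c ≤ 0`, so the value at `y` is at least `m + n - 1`,
    -- beyond the reach of `w`.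
    have hc1 : 1 ≤ c := by
      by_contra hlt
      nlinarith
    nlinarith
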